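/- Let $G$ be a topological group and let $X$ be a compact metrizable $G$-space, i.e. a compact metrizable space with a jointly continuous left action $G\times X\to X$. Let $E=E(X)$ be its enveloping semigroup, i.e. the closure of the set of translations $\{x\mapsto gx : g\in G\}$ in $X^X$ with the topology of pointwise convergence. A topological space is a Rosenthal compact if it is homeomorphic to a pointwise compact set of real-valued functions of the first Baire class on a Polish space (a function is of the first Baire class if preimages of open sets are $F_\sigma$). (1) Let $f:X\to\mathbb R$ be a continuous function which is Asplund ($f\in Asp(X)$): for every countable subgroup $H\le G$ the set $X$ with the pseudometric $\rho_{H,f}(x,y)=\sup_{h\in H}|f(hx)-f(hy)|$ is separable. Then $E^f=\{f\circ p : p\in E\}\subset\mathbb R^X$, with the topology of pointwise convergence, is a Rosenthal compact. (2) Suppose that $X$ is a Radon–Nikodým (RN) system: there are a real Banach space $V$ that is Asplund (every separable closed subspace of $V$ has norm-separable dual), a map $h$ from $G$ to the group of linear isometries of $V$ onto itself with $h(g_1g_2)=h(g_2)h(g_1)$ and with $g\mapsto h(g)v$ continuous for every $v\in V$, and a bounded map $\alpha:X\to V^*$ that is a topological embedding for the weak$^*$ topology and satisfies $\alpha(gx)(v)=\alpha(x)(h(g)v)$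 for all $g\in G$, $x\in X$, $v\in V$. Then $E$ is a separable Rosenthal compact of cardinality at most $2^{\aleph_0}$; in particular, no subspace of $E$ is homeomorphic to $\beta\mathbb N$, the Stone–Čech compactification of the discrete space $\mathbb N$. -/

import Mathlib

open Set Topology

/-- `S` is an `F_σ` set: a countable union of closed sets. -/
def IsFsigma {Z : Type*} [TopologicalSpace Z] (S : Set Z) : Prop :=
  ∃ F : ℕ → Set Z, (∀ n, IsClosed (F n)) ∧ S = ⋃ n, F n

/-- A real function is of the first Baire class: preimages of open sets are `F_σ`. -/
def IsBaireOne {Z : Type*} [TopologicalSpace Z] (φ : Z → ℝ) : Prop :=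
  ∀ U : Set ℝ, IsOpen U → IsFsigma (φ ⁻¹' U)

/-- `K` is a Rosenthal compact: it is homeomorphic to a pointwise compact set of functions of the
first Baire class on a Polish space. Every Polish space has at most continuum many points, so
nothing is lost by taking the Polish space in the lowest universe. -/
def IsRosenthalCompact (K : Type*) [TopologicalSpace K] : Prop :=
  ∃ (Z : Type) (_ : TopologicalSpace Z) (_ : PolishSpace Z) (L : Set (Z → ℝ)),
    IsCompact L ∧ (∀ φ ∈ L, IsBaireOne φ) ∧ Nonempty (K ≃ₜ L)

/-- The enveloping (Ellis) semigroup: the closure of the set of translations `x ↦ g • x` in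
`X → X` with the topology of pointwise convergence. -/
def envelopingSemigroup (G X : Type*) [Group G] [TopologicalSpace X] [MulAction G X] :
    Set (X → X) :=
  closure (range fun (g : G) (x : X) => g • x)

/-- `E^f = {f ∘ p : p ∈ E}`, a set of real functions on `X` (topologized as a subspace of
`X → ℝ`, that is, by pointwise convergence). -/
def envelopingFunctions (G : Type*) {X : Type*} [Group G] [TopologicalSpace X] [MulAction G X]
    (f : X → ℝ) : Set (X → ℝ) :=
  (fun p : X → X => f ∘ p) '' envelopingSemigroup G X

/-- The pseudometric `ρ_{H,f}(x, y) = sup_{h ∈ H} |f (h x) - f (h y)|`. -/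
noncomputable def orbitDist {G X : Type*} [Group G] [MulAction G X] (H : Subgroup G)
    (f : X → ℝ) (x y : X) : ℝ :=
  ⨆ h : H, |f ((h : G) • x) - f ((h : G) • y)|

/-- On a compact space the supremum in `orbitDist` is over a bounded set. -/
theorem bddAbove_orbitDist {G X : Type*} [Group G] [TopologicalSpace X] [CompactSpace X]
    [MulAction G X] (H : Subgroup G) (f : C(X, ℝ)) (x y : X) :
    BddAbove (range fun h : H => |f ((h : G) • x) - f ((h : G) • y)|) := by
  refine ⟨2 * ‖f‖, ?_⟩
  rintro _ ⟨h, rfl⟩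
  have h1 := f.norm_coe_le_norm ((h : G) • x)
  have h2 := f.norm_coe_le_norm ((h : G) • y)
  rw [Real.norm_eq_abs] at h1 h2
  have h3 := abs_sub (f ((h : G) • x)) (f ((h : G) • y))
  show |f ((h : G) • x) - f ((h : G) • y)| ≤ 2 * ‖f‖
  linarith

/-- `f` is an Asplund function on the compact `G`-space `X`, i.e. `f ∈ Asp(X)`: for every countable
subgroup `H` of `G` the pseudometric space `(X, ρ_{H,f})` is separable. -/
def IsAsplundFunction (G : Type*) {X : Type*} [Group G] [TopologicalSpace X] [MulAction G X]
    (f : C(X, ℝ)) : Prop :=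
  ∀ H : Subgroup G, Countable H →
    ∃ D : Set X, D.Countable ∧ ∀ x : X, ∀ ε : ℝ, 0 < ε → ∃ y ∈ D, orbitDist H f x y < ε

/-- A (real) Banach space is Asplund if the dual of each of its separable closed subspaces is
norm separable. -/
def IsAsplundSpace (V : Type*) [NormedAddCommGroup V] [NormedSpace ℝ V] : Prop :=
  ∀ W : Submodule ℝ V, IsClosed (W : Set V) → TopologicalSpace.SeparableSpace W →
    TopologicalSpace.SeparableSpace (StrongDual ℝ W)

/-- A continuous proper representation of the `G`-space `X` on the Banach space `V`: a strongly
continuous co-homomorphism `h` from `G` to the group of linear isometries of `V` onto `V`, together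
with a bounded topological embedding `α` of `X` into the dual of `V` with its weak-star topology,
which is equivariant for the dual action `(g φ)(v) = φ (h g v)`. -/
structure ProperRepresentation (G X V : Type*) [Group G] [TopologicalSpace G]
    [TopologicalSpace X] [MulAction G X] [NormedAddCommGroup V] [NormedSpace ℝ V] where
  h : G → V ≃ₗᵢ[ℝ] V
  map_mul : ∀ g₁ g₂ : G, ∀ v : V, h (g₁ * g₂) v = h g₂ (h g₁ v)
  strongly_continuous : ∀ v : V, Continuous fun g : G => h g v
  α : X → WeakDual ℝ V
  isEmbedding : IsEmbedding α
  bounded : ∃ C : ℝ, ∀ x : X, ‖WeakDual.toStrongDual (α x)‖ ≤ C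
  equivariant : ∀ (g : G) (x : X) (v : V), α (g • x) v = α x (h g v)

universe u v w

/-- `X` is a Radon-Nikodým `G`-system: it has a proper representation on some Asplund Banach
space. -/
def IsRadonNikodymSystem (G : Type u) (X : Type v) [Group G] [TopologicalSpace G]
    [TopologicalSpace X] [MulAction G X] : Prop :=
  ∃ (V : Type w) (_ : NormedAddCommGroup V) (_ : NormedSpace ℝ V) (_ : CompleteSpace V),
    IsAsplundSpace V ∧ Nonempty (ProperRepresentation G X V)

open TopologicalSpace Cardinal

/-! ### First Baire class functions -/

/-! Since `C(X, ℝ)` is separable, the orbit of `f` has a countable uniformly dense subset. The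
countable subgroup `H` generated by the corresponding group elements satisfies `|f (g x) - f (g y)|
≤ ρ_{H,f}(x, y)` for every `g`, and this survives pointwise limits. So each `f ∘ p` with `p ∈ E` is
1-Lipschitz for `ρ_{H,f}`. This pseudometric is separable and its closed balls are closed in `X`, so
preimages of open sets are countable unions of closed balls (`isBaireOne_of_le_orbitDist`).

For an RN system the matrix coefficients are Asplund and separate points. Countably many of them
embed `E` into the Baire-one functions on `X × ℕ`. Baire-one functions are Borel, so there are at
most `𝔠` of them, whereas `βℕ` maps onto a cube with `2 ^ 𝔠` points. -/

theorem IsFsigma.preimage {Y Z : Type*} [TopologicalSpace Y] [TopologicalSpace Z] {S : Set Z}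
    (hS : IsFsigma S) {e : Y → Z} (he : Continuous e) : IsFsigma (e ⁻¹' S) := by
  obtain ⟨F, hF, rfl⟩ := hS
  exact ⟨fun n => e ⁻¹' F n, fun n => (hF n).preimage he, preimage_iUnion⟩

theorem isFsigma_iUnion {Z ι : Type*} [TopologicalSpace Z] [Countable ι] {F : ι → Set Z}
    (hF : ∀ i, IsClosed (F i)) : IsFsigma (⋃ i, F i) := by
  rcases isEmpty_or_nonempty ι with h | h
  · exact ⟨fun _ => ∅, fun _ => isClosed_empty, by simp⟩
  · obtain ⟨a, ha⟩ := exists_surjective_nat ι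
    exact ⟨fun n => F (a n), fun n => hF _, (ha.iUnion_comp F).symm⟩

theorem IsBaireOne.comp_continuous {Y Z : Type*} [TopologicalSpace Y] [TopologicalSpace Z]
    {φ : Z → ℝ} (hφ : IsBaireOne φ) {e : Y → Z} (he : Continuous e) : IsBaireOne (φ ∘ e) :=
  fun U hU => (hφ U hU).preimage he

/-- A function on `Z × ι`, with `ι` countable and discrete, is of the first Baire class as soon as
its sections are. -/
theorem isBaireOne_prod {Z ι : Type*} [TopologicalSpace Z] [TopologicalSpace ι]
    [DiscreteTopology ι] [Countable ι] {φ : Z × ι → ℝ}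
    (hφ : ∀ i, IsBaireOne fun z => φ (z, i)) : IsBaireOne φ := by
  intro U hU
  choose F hF hFU using fun i => hφ i U hU
  have h : φ ⁻¹' U = ⋃ q : ι × ℕ, F q.1 q.2 ×ˢ {q.1} := by
    ext ⟨z, i⟩
    have h := Set.ext_iff.1 (hFU i) z
    simp only [mem_preimage, mem_iUnion] at h
    simp [h]
  rw [h]
  exact isFsigma_iUnion fun q => (hF q.1 q.2).prod (isClosed_discrete _)

theorem IsBaireOne.measurable {Z : Type*} [TopologicalSpace Z] [MeasurableSpace Z] [BorelSpace Z]
    {φ : Z → ℝ} (hφ : IsBaireOne φ) : Measurable φ := by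
  refine measurable_of_isOpen fun U hU => ?_
  obtain ⟨F, hF, h⟩ := hφ U hU
  rw [h]
  exact MeasurableSet.iUnion fun n => (hF n).measurableSet

theorem mk_measurableSet_le_continuum {Z : Type*} [TopologicalSpace Z]
    [SecondCountableTopology Z] [MeasurableSpace Z] [BorelSpace Z] :
    #{s : Set Z | MeasurableSet s} ≤ 𝔠 := by
  have h : ‹MeasurableSpace Z› = MeasurableSpace.generateFrom (countableBasis Z) := by
    rw [BorelSpace.measurable_eq (α := Z),
      (isBasis_countableBasis Z).borel_eq_generateFrom]
  rw [h]
  exact MeasurableSpace.cardinal_measurableSet_le_continuum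
    ((countable_countableBasis Z).le_aleph0.trans aleph0_le_continuum)

theorem mk_isBaireOne_le_continuum {Z : Type*} [TopologicalSpace Z]
    [SecondCountableTopology Z] : #{φ : Z → ℝ | IsBaireOne φ} ≤ 𝔠 := by
  borelize Z
  -- A Borel function is determined by its countably many rational sublevel sets.
  let Φ : {φ : Z → ℝ | IsBaireOne φ} → ℚ → {s : Set Z | MeasurableSet s} :=
    fun φ q => ⟨φ.1 ⁻¹' Iio (q : ℝ), φ.2.measurable measurableSet_Iio⟩
  have hΦ : Function.Injective Φ := by
    intro φ ψ h
    ext z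
    have h' : ∀ q : ℚ, φ.1 z < q ↔ ψ.1 z < q := fun q =>
      Set.ext_iff.1 (Subtype.ext_iff.1 (congrFun h q)) z
    refine le_antisymm (le_of_forall_rat_lt_imp_le ?_) (le_of_forall_rat_lt_imp_le ?_)
    · intro q hq
      by_contra! hlt
      exact hq.not_gt ((h' q).2 hlt)
    · intro q hq
      by_contra! hlt
      exact hq.not_gt ((h' q).1 hlt)
  refine (mk_le_of_injective hΦ).trans ?_
  rw [mk_pi, prod_const, lift_id', Cardinal.mkRat, lift_aleph0, ← continuum_power_aleph0]
  exact power_le_power_right mk_measurableSet_le_continuum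

/-! ### Rosenthal compacta -/

theorem IsRosenthalCompact.mk_le_continuum {K : Type v} [TopologicalSpace K]
    (hK : IsRosenthalCompact K) : #K ≤ 𝔠 := by
  obtain ⟨Z, _, _, L, -, hL, ⟨e⟩⟩ := hK
  let Φ : K → {φ : Z → ℝ | IsBaireOne φ} := fun k => ⟨(e k).1, hL _ (e k).2⟩
  have hΦ : Function.Injective Φ :=
    fun a b hab => e.injective (Subtype.ext (congrArg (fun φ => φ.1) hab :))
  have h1 := lift_mk_le_lift_mk_of_injective hΦ
  have h2 := lift_le.{v}.2 (mk_isBaireOne_le_continuum (Z := Z))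
  rw [lift_continuum] at h2
  simpa using h1.trans h2

/-- A compact metrizable space is homeomorphic to a Polish space in the lowest universe. -/
theorem exists_polishSpace_homeomorph (X : Type*) [TopologicalSpace X] [CompactSpace X]
    [MetrizableSpace X] :
    ∃ (Z : Type) (_ : TopologicalSpace Z) (_ : PolishSpace Z), Nonempty (X ≃ₜ Z) := by
  let := metrizableSpaceMetric X
  obtain ⟨e, he⟩ := exists_embedding_l_infty X
  have : PolishSpace X := inferInstance
  exact ⟨range e, inferInstance, he.toHomeomorph.symm.isClosedEmbedding.polishSpace,
    ⟨he.toHomeomorph⟩⟩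

/-- The factor `ℕ` packs a sequence of functions on `X` into a single function. Compactness of `K`
turns the continuous injection into an embedding. -/
theorem isRosenthalCompact_of_injective {K X : Type*} [TopologicalSpace K] [CompactSpace K]
    [TopologicalSpace X] [CompactSpace X] [MetrizableSpace X] (Φ : K → X × ℕ → ℝ)
    (hΦ : Continuous Φ) (hinj : Function.Injective Φ)
    (hb : ∀ k n, IsBaireOne fun x => Φ k (x, n)) : IsRosenthalCompact K := by
  obtain ⟨Z, _, _, ⟨e⟩⟩ := exists_polishSpace_homeomorph X
  let Ψ : K → Z × ℕ → ℝ := fun k z => Φ k (e.symm z.1, z.2)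
  have hΨ : Continuous Ψ := continuous_pi fun z => (continuous_apply _).comp hΦ
  have hinj' : Function.Injective Ψ := by
    intro a b hab
    refine hinj (funext fun ⟨x, n⟩ => ?_)
    simpa [Ψ] using congrFun hab (e x, n)
  refine ⟨Z × ℕ, inferInstance, inferInstance, range Ψ, isCompact_range hΨ, ?_,
    ⟨(hΨ.isClosedEmbedding hinj').isEmbedding.toHomeomorph⟩⟩
  rintro _ ⟨k, rfl⟩
  exact isBaireOne_prod fun n => (hb k n).comp_continuous e.symm.continuous

/-! ### Asplund functions -/

instance FreeGroup.instCountable {α : Type*} [Countable α] : Countable (FreeGroup α) :=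
  inferInstanceAs (Countable (Quot _))

theorem Subgroup.countable_closure {G : Type*} [Group G] {s : Set G} (hs : s.Countable) :
    Countable (Subgroup.closure s) := by
  have := hs.to_subtype
  have h := FreeGroup.range_lift_eq_closure (f := ((↑) : s → G))
  rw [Subtype.range_coe] at h
  rw [← h]
  exact (FreeGroup.lift ((↑) : s → G)).rangeRestrict_surjective.countable

section orbitDist

variable {G X : Type*} [Group G] [TopologicalSpace X] [CompactSpace X] [MulAction G X]

theorem le_orbitDist (H : Subgroup G) (f : C(X, ℝ)) (x y : X) {g : G} (hg : g ∈ H) :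
    |f (g • x) - f (g • y)| ≤ orbitDist H f x y :=
  le_ciSup (bddAbove_orbitDist H f x y) (⟨g, hg⟩ : H)

theorem orbitDist_le_iff (H : Subgroup G) (f : C(X, ℝ)) (x y : X) (r : ℝ) :
    orbitDist H f x y ≤ r ↔ ∀ h : H, |f ((h : G) • x) - f ((h : G) • y)| ≤ r :=
  ciSup_le_iff (bddAbove_orbitDist H f x y)

omit [CompactSpace X] in
theorem orbitDist_comm (H : Subgroup G) (f : C(X, ℝ)) (x y : X) :
    orbitDist H f x y = orbitDist H f y x := by
  simp only [orbitDist, abs_sub_comm]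

theorem orbitDist_triangle (H : Subgroup G) (f : C(X, ℝ)) (x y z : X) :
    orbitDist H f x z ≤ orbitDist H f x y + orbitDist H f y z :=
  (orbitDist_le_iff H f x z _).2 fun h => (abs_sub_le _ (f ((h : G) • y)) _).trans
    (add_le_add (le_orbitDist H f x y h.2) (le_orbitDist H f y z h.2))

/-- A supremum of continuous functions is lower semicontinuous. -/
theorem isClosed_orbitDist_le [ContinuousConstSMul G X] (H : Subgroup G) (f : C(X, ℝ)) (x : X)
    (r : ℝ) : IsClosed {y | orbitDist H f x y ≤ r} := by
  simp only [orbitDist_le_iff, Set.ofPred_forall]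
  exact isClosed_iInter fun h => isClosed_le
    (continuous_const.sub (f.continuous.comp (continuous_const_smul _))).abs continuous_const

/-- The supremum over `G` is already attained by some countable subgroup, uniformly in the
points. -/
theorem exists_countable_subgroup_le_orbitDist [MetrizableSpace X] [ContinuousConstSMul G X]
    (f : C(X, ℝ)) :
    ∃ H : Subgroup G, Countable H ∧
      ∀ (g : G) (x y : X), |f (g • x) - f (g • y)| ≤ orbitDist H f x y := by
  let := metrizableSpaceMetric X
  let T : G → C(X, ℝ) := fun g => ⟨fun x => f (g • x), f.continuous.comp (continuous_const_smul g)⟩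
  obtain ⟨t, htT, htc, hdense⟩ :=
    (IsSeparable.of_separableSpace (range T)).exists_countable_dense_subset
  choose! γ hγ using fun φ (hφ : φ ∈ t) => htT hφ
  refine ⟨Subgroup.closure (γ '' t), Subgroup.countable_closure (htc.image γ), fun g x y => ?_⟩
  have hcl : IsClosed {φ : C(X, ℝ) | |φ x - φ y| ≤ orbitDist (Subgroup.closure (γ '' t)) f x y} :=
    isClosed_le ((continuous_eval_const x).sub (continuous_eval_const y)).abs continuous_const
  refine closure_minimal ?_ hcl (hdense (mem_range_self g))
  intro φ hφ
  have h := le_orbitDist _ f x y (Subgroup.subset_closure (mem_image_of_mem γ hφ))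
  have h' : ∀ z, φ z = f (γ φ • z) := fun z => (DFunLike.congr_fun (hγ φ hφ) z).symm
  simpa only [Set.mem_ofPred_eq, h'] using h

/-- A function dominated by a separable `orbitDist` pseudometric is of the first Baire class. -/
theorem isBaireOne_of_le_orbitDist [ContinuousConstSMul G X] (H : Subgroup G) (f : C(X, ℝ))
    {D : Set X} (hD : D.Countable)
    (hDd : ∀ x : X, ∀ ε : ℝ, 0 < ε → ∃ y ∈ D, orbitDist H f x y < ε) {q : X → ℝ}
    (hq : ∀ x y, |q x - q y| ≤ orbitDist H f x y) : IsBaireOne q := by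
  intro U hU
  have := hD.to_subtype
  -- The closed balls with centre in `D` and rational radius that stay inside the preimage; a radius
  -- below `ε / 2` suffices by the triangle inequality.
  let I := {i : D × ℚ // {y | orbitDist H f i.1 y ≤ i.2} ⊆ q ⁻¹' U}
  have h : q ⁻¹' U = ⋃ i : I, {y | orbitDist H f i.1.1 y ≤ i.1.2} := by
    refine Subset.antisymm (fun x hx => ?_) (iUnion_subset fun i => i.2)
    obtain ⟨ε, hε, hball⟩ := Metric.isOpen_iff.1 hU (q x) hx
    obtain ⟨r, hr0, hr⟩ := exists_rat_btwn (half_pos hε)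
    obtain ⟨d, hd, hxd⟩ := hDd x r hr0
    refine mem_iUnion.2 ⟨⟨⟨⟨d, hd⟩, r⟩, fun y hy => hball ?_⟩, ?_⟩
    · have h1 := orbitDist_triangle H f x d y
      have h2 := hq x y
      have h3 : orbitDist H f d y ≤ r := hy
      rw [Metric.mem_ball, Real.dist_eq, abs_sub_comm]
      linarith
    · rw [Set.mem_ofPred_eq, orbitDist_comm]
      exact hxd.le
  rw [h]
  exact isFsigma_iUnion fun i => isClosed_orbitDist_le H f _ _

/-- The Lipschitz bound is a pointwise closed condition on `p` and holds for translations. -/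
theorem IsAsplundFunction.isBaireOne_comp [MetrizableSpace X] [ContinuousConstSMul G X]
    {f : C(X, ℝ)} (hf : IsAsplundFunction G f) {p : X → X} (hp : p ∈ envelopingSemigroup G X) :
    IsBaireOne (f ∘ p) := by
  obtain ⟨H, hH, hle⟩ := exists_countable_subgroup_le_orbitDist (G := G) f
  obtain ⟨D, hD, hDd⟩ := hf H hH
  refine isBaireOne_of_le_orbitDist H f hD hDd fun x y => ?_
  have hcl : IsClosed {p : X → X | |f (p x) - f (p y)| ≤ orbitDist H f x y} :=
    isClosed_le ((f.continuous.comp (continuous_apply x)).sub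
      (f.continuous.comp (continuous_apply y))).abs continuous_const
  refine closure_minimal ?_ hcl hp
  rintro _ ⟨g, rfl⟩
  exact hle g x y

theorem isCompact_envelopingSemigroup : IsCompact (envelopingSemigroup G X) :=
  isClosed_closure.isCompact

theorem isCompact_envelopingFunctions (f : C(X, ℝ)) : IsCompact (envelopingFunctions G f) :=
  isCompact_envelopingSemigroup.image
    (continuous_pi fun x => f.continuous.comp (continuous_apply x))

theorem IsAsplundFunction.isRosenthalCompact_envelopingFunctions [MetrizableSpace X]
    [ContinuousConstSMul G X] {f : C(X, ℝ)} (hf : IsAsplundFunction G f) :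
    IsRosenthalCompact (envelopingFunctions G f) := by
  have : CompactSpace (envelopingFunctions G f) :=
    isCompact_iff_compactSpace.1 (isCompact_envelopingFunctions f)
  refine isRosenthalCompact_of_injective (X := X) (fun φ z => φ.1 z.1)
    (continuous_pi fun z => (continuous_apply z.1).comp continuous_subtype_val)
    -- The `ℕ` coordinate is redundant here, so the slice at `0` already recovers the function.
    (fun φ ψ h => Subtype.ext (funext fun x => congrFun h (x, 0))) ?_
  rintro ⟨_, p, hp, rfl⟩ -
  exact hf.isBaireOne_comp hp

/-- If Asplund functions separate the points, then the enveloping semigroup is a Rosenthal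
compact. -/
theorem isRosenthalCompact_envelopingSemigroup [MetrizableSpace X] [ContinuousConstSMul G X]
    (A : Set C(X, ℝ)) (hne : A.Nonempty) (hA : ∀ f ∈ A, IsAsplundFunction G f)
    (hsep : ∀ x y : X, (∀ f ∈ A, f x = f y) → x = y) :
    IsRosenthalCompact (envelopingSemigroup G X) := by
  let := metrizableSpaceMetric X
  have : CompactSpace (envelopingSemigroup G X) :=
    isCompact_iff_compactSpace.1 isCompact_envelopingSemigroup
  obtain ⟨t, htA, htc, hdense⟩ := (IsSeparable.of_separableSpace A).exists_countable_dense_subset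
  have htne : t.Nonempty := closure_nonempty_iff.1 (hne.mono hdense)
  obtain ⟨F, rfl⟩ := htc.exists_eq_range htne
  refine isRosenthalCompact_of_injective (X := X) (fun p z => F z.2 (p.1 z.1))
    (continuous_pi fun z =>
      (F z.2).continuous.comp ((continuous_apply z.1).comp continuous_subtype_val)) ?_
    fun p n => (hA _ (htA (mem_range_self n))).isBaireOne_comp p.2
  refine fun p q h => Subtype.ext (funext fun x => hsep _ _ fun f hf => ?_)
  have hcl : IsClosed {φ : C(X, ℝ) | φ (p.1 x) = φ (q.1 x)} :=
    isClosed_eq (continuous_eval_const _) (continuous_eval_const _)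
  refine closure_minimal ?_ hcl (hdense hf)
  rintro _ ⟨n, rfl⟩
  exact congrFun h (x, n)

/-- The translations have a countable dense subset in the separable metrizable space `C(X, X)`, and
the topology there is finer than pointwise convergence. -/
theorem separableSpace_envelopingSemigroup [MetrizableSpace X] [ContinuousConstSMul G X] :
    SeparableSpace (envelopingSemigroup G X) := by
  let := metrizableSpaceMetric X
  let T : G → C(X, X) := fun g => ⟨fun x => g • x, continuous_const_smul g⟩
  have h1 : IsSeparable (range T) := IsSeparable.of_separableSpace _
  obtain ⟨t, htT, htc, hdense⟩ := h1.exists_countable_dense_subset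
  let c : C(X, X) → X → X := fun φ => φ
  have hc : Continuous c := continuous_pi fun x => continuous_eval_const x
  have h2 : c '' t ⊆ envelopingSemigroup G X := by
    rintro _ ⟨φ, hφ, rfl⟩
    obtain ⟨g, rfl⟩ := htT hφ
    exact subset_closure ⟨g, rfl⟩
  have h3 : envelopingSemigroup G X ⊆ closure (c '' t) := by
    refine closure_minimal ?_ isClosed_closure
    rintro _ ⟨g, rfl⟩
    exact image_closure_subset_closure_image hc ⟨T g, hdense ⟨g, rfl⟩, rfl⟩
  refine ⟨⟨Subtype.val ⁻¹' (c '' t),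
    (htc.image c).preimage Subtype.val_injective, ?_⟩⟩
  rw [Subtype.dense_iff]
  intro p hp
  rw [Subtype.image_preimage_coe, inter_eq_right.2 h2]
  exact h3 hp

end orbitDist

/-! ### Radon-Nikodým systems -/

section RadonNikodym

variable {G X V : Type*} [Group G] [TopologicalSpace G] [TopologicalSpace X] [MulAction G X]
  [NormedAddCommGroup V] [NormedSpace ℝ V]

/-- The matrix coefficient `x ↦ α x v` of a representation. -/
noncomputable def ProperRepresentation.coeff (R : ProperRepresentation G X V) (v : V) : C(X, ℝ) :=
  ⟨fun x => R.α x v, (WeakDual.eval_continuous v).comp R.isEmbedding.continuous⟩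

/-- The countable `H`-orbit of `v` spans a separable `W`, whose dual is separable. By isometry the
orbit lies in the ball of radius `‖v‖`, so the dual norm on `W` bounds `ρ_{H,f}` up to that factor.
-/
theorem ProperRepresentation.isAsplundFunction_coeff (R : ProperRepresentation G X V)
    (hV : IsAsplundSpace V) (v : V) : IsAsplundFunction G (R.coeff v) := by
  intro H hH
  rcases isEmpty_or_nonempty X with hX | hX
  · exact ⟨∅, countable_empty, fun x => isEmptyElim x⟩
  let W : Submodule ℝ V := (Submodule.span ℝ (range fun h : H => R.h h v)).topologicalClosure
  have hW : IsSeparable (W : Set V) := by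
    rw [Submodule.topologicalClosure_coe]
    exact ((countable_range _).isSeparable.span).closure
  have := hV W (Submodule.isClosed_topologicalClosure _) hW.separableSpace
  have : PseudoMetrizableSpace (StrongDual ℝ W) :=
    @PseudoEMetricSpace.pseudoMetrizableSpace (StrongDual ℝ W) inferInstance
  let ρ : X → StrongDual ℝ W := fun x => (WeakDual.toStrongDual (R.α x)).comp W.subtypeL
  obtain ⟨t, htρ, htc, hdense⟩ :=
    (IsSeparable.of_separableSpace (range ρ)).exists_countable_dense_subset
  choose! γ hγ using fun φ (hφ : φ ∈ t) => htρ hφ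
  refine ⟨γ '' t, htc.image γ, fun x ε hε => ?_⟩
  -- The `+ 1` covers `v = 0`; the `2` makes the bound strict after taking the supremum.
  have hδ : 0 < ε / (2 * (‖v‖ + 1)) := by positivity
  obtain ⟨φ, hφ, hd⟩ := (Metric.mem_closure_iff (α := StrongDual ℝ W)).1
    (hdense (mem_range_self x)) _ hδ
  refine ⟨γ φ, mem_image_of_mem γ hφ, ?_⟩
  have hle : orbitDist H (R.coeff v) x (γ φ) ≤ ε / 2 := by
    refine ciSup_le fun h => ?_
    have hmem : R.h h v ∈ W := Submodule.le_topologicalClosure _ (Submodule.subset_span ⟨h, rfl⟩)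
    have h1 : R.coeff v ((h : G) • x) - R.coeff v ((h : G) • γ φ) =
        (ρ x - φ) ⟨R.h h v, hmem⟩ := by
      have h3 := DFunLike.congr_fun (hγ φ hφ) ⟨R.h h v, hmem⟩
      rw [sub_apply, ← h3]
      exact congrArg₂ (· - ·) (R.equivariant h x v) (R.equivariant h (γ φ) v)
    have h2 : ‖(⟨R.h h v, hmem⟩ : W)‖ = ‖v‖ := (R.h h).norm_map v
    rw [h1, ← Real.norm_eq_abs]
    refine (ContinuousLinearMap.le_opNorm _ _).trans ?_
    rw [h2]
    have h4 : ‖ρ x - φ‖ < ε / (2 * (‖v‖ + 1)) := (dist_eq_norm (ρ x) φ).symm.trans_lt hd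
    calc ‖ρ x - φ‖ * ‖v‖ ≤ ε / (2 * (‖v‖ + 1)) * (‖v‖ + 1) := by gcongr; linarith
      _ = ε / 2 := by field_simp
  linarith

theorem ProperRepresentation.eq_of_coeff_eq (R : ProperRepresentation G X V) {x y : X}
    (h : ∀ v, R.coeff v x = R.coeff v y) : x = y :=
  R.isEmbedding.injective (DFunLike.ext _ _ h)

end RadonNikodym

/-! ### The Stone–Čech compactification of the integers -/

/-- The cube `Bool ^ (Set ℕ)` is separable. -/
theorem exists_denseRange_bool_cube : ∃ d : ℕ → Set ℕ → Bool, DenseRange d := by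
  classical
  -- Countably many points of the cube, each seeing `S` only through its trace on a finite set. Any
  -- finitely many `S` have distinct traces on a suitable finite set, so every finite pattern
  -- occurs.
  let e : Finset ℕ × Finset (Finset ℕ) → Set ℕ → Bool :=
    fun q S => decide (q.1.filter (· ∈ S) ∈ q.2)
  suffices he : DenseRange e by
    obtain ⟨a, ha⟩ := exists_surjective_nat (Finset ℕ × Finset (Finset ℕ))
    exact ⟨e ∘ a, by rwa [DenseRange, ha.range_comp]⟩
  intro b
  refine mem_closure_iff_nhds.2 fun U hU => ?_
  rw [nhds_pi, Filter.mem_pi'] at hU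
  obtain ⟨I, T, hT, hIU⟩ := hU
  have hsep : ∃ F : Finset ℕ, ∀ S ∈ I, ∀ S' ∈ I,
      F.filter (· ∈ S) = F.filter (· ∈ S') → S = S' := by
    have hex : ∀ q : Set ℕ × Set ℕ, ∃ n : ℕ, q.1 ≠ q.2 → ¬(n ∈ q.1 ↔ n ∈ q.2) := by
      intro q
      by_cases h : q.1 = q.2
      · exact ⟨0, fun h' => absurd h h'⟩
      · obtain ⟨n, hn⟩ := not_forall.1 (mt Set.ext h)
        exact ⟨n, fun _ => hn⟩
    choose n hn using hex
    refine ⟨(I ×ˢ I).image n, fun S hS S' hS' h => ?_⟩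
    by_contra hne
    refine hn (S, S') hne ?_
    have hmem : n (S, S') ∈ (I ×ˢ I).image n :=
      Finset.mem_image_of_mem n (Finset.mk_mem_product hS hS')
    simpa [Finset.mem_filter, hmem] using Finset.ext_iff.1 h (n (S, S'))
  obtain ⟨F, hF⟩ := hsep
  refine ⟨e (F, (I.filter (b · = true)).image fun S => F.filter (· ∈ S)), hIU fun S hS => ?_,
    mem_range_self _⟩
  convert mem_of_mem_nhds (hT S) using 1
  rw [Bool.eq_iff_iff, decide_eq_true_iff, Finset.mem_image]
  constructor
  · rintro ⟨S', hS', h⟩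
    rw [Finset.mem_filter] at hS'
    exact hF S' hS'.1 S hS h ▸ hS'.2
  · exact fun h => ⟨S, Finset.mem_filter.2 ⟨hS, h⟩, rfl⟩

theorem continuum_lt_mk_stoneCech_nat : 𝔠 < #(StoneCech ℕ) := by
  obtain ⟨d, hd⟩ := exists_denseRange_bool_cube
  have hc : Continuous d := continuous_of_discreteTopology
  -- The image is compact, hence closed, and contains the dense sequence.
  have hsurj : Function.Surjective (stoneCechExtend hc) := by
    rw [← range_eq_univ, ← (isCompact_range (continuous_stoneCechExtend hc)).isClosed.closure_eq]
    refine (hd.mono ?_).closure_eq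
    rintro _ ⟨n, rfl⟩
    exact ⟨stoneCechUnit n, stoneCechExtend_stoneCechUnit hc n⟩
  calc 𝔠 < 2 ^ 𝔠 := cantor _
    _ = #(Set ℕ → Bool) := by simp
    _ ≤ #(StoneCech ℕ) := mk_le_of_surjective hsurj

theorem mainTheorem3 {G : Type u} {X : Type v} [Group G] [TopologicalSpace G] [IsTopologicalGroup G]
    [TopologicalSpace X] [CompactSpace X] [TopologicalSpace.MetrizableSpace X]
    [MulAction G X] [ContinuousSMul G X] :
    (∀ f : C(X, ℝ), IsAsplundFunction G f → IsRosenthalCompact (envelopingFunctions G f)) ∧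
    (IsRadonNikodymSystem.{u, v, w} G X →
      IsRosenthalCompact (envelopingSemigroup G X) ∧
      TopologicalSpace.SeparableSpace (envelopingSemigroup G X) ∧
      Cardinal.mk (envelopingSemigroup G X) ≤ Cardinal.continuum ∧
      ∀ S : Set (envelopingSemigroup G X), IsEmpty (S ≃ₜ StoneCech ℕ)) := by
  
  refine ⟨fun f hf => hf.isRosenthalCompact_envelopingFunctions, ?_⟩
  rintro ⟨V, _, _, _, hV, ⟨R⟩⟩
  have hE : IsRosenthalCompact (envelopingSemigroup G X) :=
    isRosenthalCompact_envelopingSemigroup (range R.coeff) (range_nonempty _)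
      (by rintro _ ⟨v, rfl⟩; exact R.isAsplundFunction_coeff hV v)
      fun x y h => R.eq_of_coeff_eq fun v => h _ (mem_range_self v)
  refine ⟨hE, separableSpace_envelopingSemigroup, hE.mk_le_continuum, fun S => ⟨fun e => ?_⟩⟩
  have h1 : #S ≤ 𝔠 := (mk_set_le S).trans hE.mk_le_continuum
  have h2 := Cardinal.lift_mk_eq'.2 ⟨e.toEquiv⟩
  have h3 := lift_lt.{0, v}.2 continuum_lt_mk_stoneCech_nat
  rw [← h2, lift_continuum, ← lift_continuum.{0, v}] at h3
  exact absurd h3 (by simpa using h1)
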